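/- Let $\mathbb N=\{1,2,3,\dots\}$ and let $\mathrm{Fin}\,\mathbb N$ be the set of finite nonempty subsets of $\mathbb N$. Every ordinal $\xi$ is written uniquely as $\xi=\gamma(\xi)+n(\xi)$ with $\gamma(\xi)$ a limit ordinal or $0$ and $n(\xi)\in\mathbb N\cup\{0\}$. **Complementary-finite asymptotic dimension.** A family $\mathcal U$ of subsets of a metric space $X$ is *$r$-disjoint* if $d(x,y)\ge r$ for all $x\in U$, $y\in V$ whenever $U\ne V$ are members of $\mathcal U$, and *uniformly bounded* if the diameters of its members have a common finite bound. Put $\operatorname{coasdim}(X)=-1$ if and only if $X=\varnothing$. Inductively, for an ordinal $\gamma=\lambda+n$ with $\lambda$ a limit ordinal or $0$ and $n$ finite, $\operatorname{coasdim}(X)\le\gamma$ means that for every $r>0$ there are $r$-disjoint uniformly bounded families $\mathcal U_0,\dots,\mathcal U_n$ of subsets of $X$ such that $\operatorname{coasdim}\bigl(X\setminus\bigcup\bigcup_{i=0}^n\mathcal U_i\bigr)<\lambda$, i.e. this remainder is empty or has $\operatorname{coasdim}\le\beta$ for some $\beta<\lambda$. **The families $S_\xi$.** For each countable limit ordinal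 $\alpha$ fix ordinals $\zeta_i(\alpha)$, $i\in\mathbb N$, each a limit ordinal or $0$, such that the sequence $(\zeta_i(\alpha)+i)_i$ is increasing with supremum $\alpha$, and such that $\zeta_i(\alpha)=\beta$ for all $i$ whenever $\alpha=\sup_i(\beta+i)$ for a limit ordinal $\beta$. For $\tau=\{k_0<k_1<\dots<k_s\}\in\mathrm{Fin}\,\mathbb N$ and $n\ge 0$ put $K(\tau,n)=\{k_{n+1},\dots,k_s\}$ (empty if $n\ge s$) and $i(\tau,n)=k_{\min(n,s)}$. For finite $\xi=n$ let $S_n=\{\sigma\in\mathrm{Fin}\,\mathbb N : |\sigma|\le n\}$ (so $S_0=\varnothing$). For infinite countable $\xi$ let, by recursion, $S_\xi$ be the set of those $\sigma\in\mathrm{Fin}\,\mathbb N$ such that $K(\sigma,n(\xi))=\varnothing$ or $K(\sigma,n(\xi))\in S_{\zeta_l(\gamma(\xi))+l}$ for some $l\in\{1,\dots,i(\sigma,n(\xi))\}$. Let $S_\xi[L]=\{\{k_0+2,\dots,k_s+2\} : \{k_0,\dots,k_s\}\in S_\xi\}$. **The spaces $X_\xi$.** For $\tau=\{k_0+2<\dots<k_m+2\}\in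 S_\xi[L]$ let $$X_\tau=\Bigl\{(x_i)_{i=0}^m\in(2^{k_0}\mathbb Z)^{m+1} : |\{j : x_j\notin 2^{k_p}\mathbb Z\}|\le p\ \text{ for every } p\in\{0,\dots,m\}\Bigr\},$$ let $i_\tau$ send $x\in X_\tau$ to its extension by zeros in $\bigoplus\mathbb Z$, the set of finitely supported integer sequences, let $\rho$ be the sup-metric on $\bigoplus\mathbb Z$, and let $s(\tau)=2^{\max\tau}$. Let $X_\xi=\bigsqcup_{\tau\in S_\xi[L]}X_\tau$ with the metric $d_\xi(x,y)=\rho(i_\tau(x),i_\tau(y))$ if $x,y\in X_\tau$, and $d_\xi(x,y)=\max\{s(\tau_1),s(\tau_2),\rho(i_{\tau_1}(x),i_{\tau_2}(y))\}$ if $x\in X_{\tau_1}$, $y\in X_{\tau_2}$ with $\tau_1\ne\tau_2$. **Theorem.** For every such choice of the $\zeta_i(\alpha)$ and every countable (finite or infinite) ordinal $\xi$, $$\operatorname{coasdim}(X_\xi)\le\xi .$$ -/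

import Mathlib

namespace CofinDim

/-! ### Decomposition of an ordinal as (limit or zero) + (natural number) -/

/-- The part `γ` of `ξ = γ + n`, where `γ` is a limit ordinal or `0` and `n` is finite. -/
noncomputable def limitPart (ξ : Ordinal.{0}) : Ordinal.{0} := Ordinal.omega0 * (ξ / Ordinal.omega0)

/-- The part `n` of `ξ = γ + n`, where `γ` is a limit ordinal or `0` and `n` is finite. -/
noncomputable def natPart (ξ : Ordinal.{0}) : ℕ := Cardinal.toNat (ξ % Ordinal.omega0).card

theorem limitPart_add_natPart (ξ : Ordinal.{0}) : limitPart ξ + (natPart ξ : Ordinal.{0}) = ξ := by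
  obtain ⟨n, hn⟩ := Ordinal.lt_omega0.1 (Ordinal.mod_lt ξ Ordinal.omega0_ne_zero)
  have h : (natPart ξ : Ordinal.{0}) = ξ % Ordinal.omega0 := by
    unfold natPart
    rw [hn]
    simp
  rw [h]
  exact Ordinal.div_add_mod ξ Ordinal.omega0

theorem limitPart_eq_zero_or_isSuccLimit (ξ : Ordinal.{0}) :
    limitPart ξ = 0 ∨ Order.IsSuccLimit (limitPart ξ) := by
  unfold limitPart
  rcases eq_or_ne (ξ / Ordinal.omega0) 0 with h | h
  · left
    rw [h, mul_zero]
  · right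
    exact Ordinal.isSuccLimit_mul_left Ordinal.isSuccLimit_omega0 (pos_iff_ne_zero.2 h)

theorem limitPart_le (ξ : Ordinal.{0}) : limitPart ξ ≤ ξ :=
  Ordinal.mul_div_le ξ Ordinal.omega0

/-! ### Complementary-finite asymptotic dimension -/

section Coasdim

variable {X : Type*} [MetricSpace X]

/-- A family of subsets is `r`-disjoint if distinct members are at distance at least `r`. -/
def RDisjoint (r : ℝ) (𝒰 : Set (Set X)) : Prop :=
  ∀ U ∈ 𝒰, ∀ V ∈ 𝒰, U ≠ V → ∀ x ∈ U, ∀ y ∈ V, r ≤ dist x y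

/-- A family of subsets is uniformly bounded if the diameters of its members are bounded by a
common constant. -/
def UniformlyBounded (𝒰 : Set (Set X)) : Prop :=
  ∃ R : ℝ, ∀ U ∈ 𝒰, ∀ x ∈ U, ∀ y ∈ U, dist x y ≤ R

/-- `CoasdimLE γ A` says that the subspace `A` of `X` has complementary-finite asymptotic
dimension at most `γ = λ + n` (with `λ` a limit ordinal or `0`, and `n` finite): for every `r > 0`
there are `n + 1` uniformly bounded `r`-disjoint families of subsets of `A` such that the set
of the points of `A` that they do not cover has complementary-finite asymptotic dimension `< λ`,
that is, it is empty (dimension `-1`) or has dimension at most `β` for some `β < λ`. -/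
def CoasdimLE (γ : Ordinal.{0}) (A : Set X) : Prop :=
  ∀ r : ℝ, 0 < r → ∃ 𝒰 : Fin (natPart γ + 1) → Set (Set X),
    (∀ i, (∀ U ∈ 𝒰 i, U ⊆ A) ∧ RDisjoint r (𝒰 i) ∧ UniformlyBounded (𝒰 i)) ∧
    ((A \ ⋃ i, ⋃₀ 𝒰 i) = ∅ ∨
      ∃ β : Ordinal.{0}, ∃ _ : β < limitPart γ, CoasdimLE β (A \ ⋃ i, ⋃₀ 𝒰 i))
termination_by γ
decreasing_by exact lt_of_lt_of_le (by assumption) (limitPart_le γ)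

end Coasdim

/-! ### The families `S_ξ` -/

/-- `IsFundamental ζ`: for every countable limit ordinal `α`, the ordinals `ζ α i + i`,
`i = 1, 2, …`, form an increasing sequence with supremum `α`, each `ζ α i` is a limit ordinal
or `0`, and `ζ α i = β` for all `i` whenever `α = sup_i (β + i)` with `β` a limit ordinal.
(The value `ζ α 0` plays no role.) -/
def IsFundamental (ζ : Ordinal.{0} → ℕ → Ordinal.{0}) : Prop :=
  ∀ α : Ordinal.{0}, α.card ≤ Cardinal.aleph0 → Order.IsSuccLimit α →
    (∀ i : ℕ, 1 ≤ i → ζ α i = 0 ∨ Order.IsSuccLimit (ζ α i)) ∧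
    (∀ i j : ℕ, 1 ≤ i → i < j → ζ α i + (i : Ordinal.{0}) < ζ α j + (j : Ordinal.{0})) ∧
    IsLUB {δ : Ordinal.{0} | ∃ i : ℕ, 1 ≤ i ∧ δ = ζ α i + (i : Ordinal.{0})} α ∧
    (∀ β : Ordinal.{0}, Order.IsSuccLimit β →
      IsLUB {δ : Ordinal.{0} | ∃ i : ℕ, 1 ≤ i ∧ δ = β + (i : Ordinal.{0})} α →
      ∀ i : ℕ, 1 ≤ i → ζ α i = β)

/-- The finite nonempty sets of positive integers. -/
def FinN : Set (Finset ℕ) := {σ | σ.Nonempty ∧ ∀ k ∈ σ, 1 ≤ k}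

/-- For `τ = {k₀ < k₁ < ⋯ < kₛ}` and `p ≤ s`, this is `k_p`. -/
noncomputable def elt (τ : Finset ℕ) (p : ℕ) : ℕ := Nat.nth (fun k => k ∈ τ) p

/-- For `τ = {k₀ < ⋯ < kₛ}`: `tail τ n = {k_{n+1}, …, kₛ}`, which is empty if `n ≥ s`. -/
noncomputable def tail (τ : Finset ℕ) (n : ℕ) : Finset ℕ :=
  (Finset.Ioo n τ.card).image (elt τ)

/-- For `τ = {k₀ < ⋯ < kₛ}`: `idx τ n` is `k_n` if `n ≤ s` and `kₛ` if `n > s`. -/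
noncomputable def idx (τ : Finset ℕ) (n : ℕ) : ℕ := elt τ (min n (τ.card - 1))

/-- The family `S_ξ`. For finite `ξ = n` it consists of the sets with at most `n` elements.
For infinite `ξ = γ + n` it consists of the `σ` such that `tail σ n` is empty or lies in
`S_{ζ_l(γ) + l}` for some `l ∈ {1, …, idx σ n}`.
(The inequality between ordinals only makes the recursion well-founded: it holds whenever
`IsFundamental ζ` and `ξ` is countable.) -/
def S (ζ : Ordinal.{0} → ℕ → Ordinal.{0}) (ξ : Ordinal.{0}) : Set (Finset ℕ) :=
  {σ | σ ∈ FinN ∧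
    ((limitPart ξ = 0 ∧ σ.card ≤ natPart ξ) ∨
     (limitPart ξ ≠ 0 ∧
      (tail σ (natPart ξ) = ∅ ∨
        ∃ l : ℕ, 1 ≤ l ∧ l ≤ idx σ (natPart ξ) ∧
          ∃ _ : ζ (limitPart ξ) l + (l : Ordinal.{0}) < limitPart ξ,
            tail σ (natPart ξ) ∈ S ζ (ζ (limitPart ξ) l + (l : Ordinal.{0})))))}
termination_by ξ
decreasing_by exact lt_of_lt_of_le (by assumption) (limitPart_le ξ)

/-- The family `M[L]` for `L = {3, 4, 5, …}`: the sets `{k₀ + 2, …, kₛ + 2}` with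
`{k₀, …, kₛ} ∈ M`. -/
def shift (M : Set (Finset ℕ)) : Set (Finset ℕ) :=
  {τ | ∃ σ ∈ M, τ = σ.image (fun k => k + 2)}

/-! ### The spaces `X_τ` and `X_ξ` -/

/-- For `τ = {k₀ + 2 < k₁ + 2 < ⋯ < kₘ + 2}`: the set `X_τ` of all
`x = (x₀, …, xₘ) ∈ (2^{k₀} ℤ)^{m+1}` such that, for every `p ∈ {0, …, m}`, at most `p` of the
coordinates `x_j` are not in `2^{k_p} ℤ`. -/
def piece (τ : Finset ℕ) : Set (Fin τ.card → ℤ) :=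
  {x | (∀ j, (2 : ℤ) ^ (elt τ 0 - 2) ∣ x j) ∧
    ∀ p : Fin τ.card, Set.ncard {j | ¬ (2 : ℤ) ^ (elt τ p - 2) ∣ x j} ≤ p}

/-- The sup-metric on the group `⨁ ℤ` of finitely supported integer sequences. -/
noncomputable def rho (x y : ℕ →₀ ℤ) : ℝ :=
  ((x - y).support.sup (fun i => (x i - y i).natAbs) : ℕ)

/-- Extension of a finite integer sequence by zeros. -/
noncomputable def extend {n : ℕ} (x : Fin n → ℤ) : ℕ →₀ ℤ :=
  Finsupp.onFinset (Finset.range n) (fun i => if h : i < n then x ⟨i, h⟩ else 0) (by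
    intro i hi
    by_contra hn
    simp only [Finset.mem_range] at hn
    simp [hn] at hi)

/-- `s(τ) = 2 ^ (max τ)`. -/
def scale (τ : Finset ℕ) : ℝ := 2 ^ (τ.sup id)

/-- The disjoint union of the sets `X_τ`, `τ ∈ T`. -/
def Space (T : Set (Finset ℕ)) : Type := Σ τ : T, ↥(piece τ.1)

/-- The finitely supported sequence given by a point of the disjoint union. -/
noncomputable def Space.seq {T : Set (Finset ℕ)} (x : Space T) : ℕ →₀ ℤ := extend x.2.1

/-- The distance on the disjoint union of the sets `X_τ`. -/
noncomputable def Space.distance {T : Set (Finset ℕ)} (x y : Space T) : ℝ :=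
  if x.1 = y.1 then rho x.seq y.seq
  else max (max (scale x.1) (scale y.1)) (rho x.seq y.seq)

theorem rho_le_iff {x y : ℕ →₀ ℤ} {a : ℝ} (ha : 0 ≤ a) :
    rho x y ≤ a ↔ ∀ i, |((x i : ℤ) : ℝ) - (y i : ℝ)| ≤ a := by
  have key : ∀ i, |((x i : ℤ) : ℝ) - (y i : ℝ)| = (((x i - y i).natAbs : ℕ) : ℝ) := by
    intro i
    rw [Nat.cast_natAbs]
    push_cast
    rfl
  unfold rho
  rw [← Nat.le_floor_iff ha, Finset.sup_le_iff]
  constructor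
  · intro h i
    rw [key, ← Nat.le_floor_iff ha]
    by_cases hi : i ∈ (x - y).support
    · exact h i hi
    · have : x i - y i = 0 := by simpa using hi
      simp [this]
  · intro h i _
    rw [Nat.le_floor_iff ha, ← key]
    exact h i

theorem rho_nonneg (x y : ℕ →₀ ℤ) : 0 ≤ rho x y := Nat.cast_nonneg _

theorem abs_sub_le_rho (x y : ℕ →₀ ℤ) (i : ℕ) : |((x i : ℤ) : ℝ) - (y i : ℝ)| ≤ rho x y :=
  (rho_le_iff (rho_nonneg x y)).1 le_rfl i

theorem rho_self (x : ℕ →₀ ℤ) : rho x x = 0 :=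
  le_antisymm ((rho_le_iff le_rfl).2 (by simp)) (rho_nonneg x x)

theorem rho_comm (x y : ℕ →₀ ℤ) : rho x y = rho y x := by
  apply le_antisymm
  · exact (rho_le_iff (rho_nonneg _ _)).2 fun i => by
      rw [abs_sub_comm]
      exact abs_sub_le_rho y x i
  · exact (rho_le_iff (rho_nonneg _ _)).2 fun i => by
      rw [abs_sub_comm]
      exact abs_sub_le_rho x y i

theorem rho_triangle (x y z : ℕ →₀ ℤ) : rho x z ≤ rho x y + rho y z :=
  (rho_le_iff (add_nonneg (rho_nonneg _ _) (rho_nonneg _ _))).2 fun i =>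
    (abs_sub_le _ _ _).trans (add_le_add (abs_sub_le_rho x y i) (abs_sub_le_rho y z i))

theorem eq_of_rho_eq_zero {x y : ℕ →₀ ℤ} (h : rho x y = 0) : x = y := by
  ext i
  have := abs_sub_le_rho x y i
  rw [h] at this
  have h0 := sub_eq_zero.1 (abs_eq_zero.1 (le_antisymm this (abs_nonneg _)))
  exact_mod_cast h0

theorem extend_apply {n : ℕ} (x : Fin n → ℤ) (i : Fin n) : extend x i = x i := by
  simp [extend]

theorem extend_injective {n : ℕ} : Function.Injective (extend : (Fin n → ℤ) → ℕ →₀ ℤ) := by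
  intro x y h
  ext i
  rw [← extend_apply x i, h, extend_apply]

theorem scale_pos (τ : Finset ℕ) : 0 < scale τ := by
  unfold scale
  positivity

noncomputable instance (T : Set (Finset ℕ)) : MetricSpace (Space T) where
  dist := Space.distance
  dist_self x := by simp [Space.distance, rho_self]
  dist_comm x y := by
    simp only [Space.distance, rho_comm x.seq y.seq, eq_comm (a := x.1) (b := y.1),
      max_comm (scale x.1) (scale y.1)]
  dist_triangle x y z := by
    have h1 := rho_triangle x.seq y.seq z.seq
    have h2 := rho_nonneg x.seq y.seq
    have h3 := rho_nonneg y.seq z.seq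
    have hx := scale_pos x.1
    have hy := scale_pos y.1
    have hz := scale_pos z.1
    change Space.distance x z ≤ Space.distance x y + Space.distance y z
    unfold Space.distance
    by_cases hxy : x.1 = y.1 <;> by_cases hyz : y.1 = z.1
    · simp [hxy, hyz, h1]
    · rw [hxy, if_neg hyz, if_pos rfl, if_neg hyz]
      have := le_max_left (max (scale y.1) (scale z.1)) (rho y.seq z.seq)
      have := le_max_right (max (scale y.1) (scale z.1)) (rho y.seq z.seq)
      exact max_le (by linarith) (by linarith)
    · rw [← hyz, if_neg hxy, if_neg hxy, if_pos rfl]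
      have := le_max_left (max (scale x.1) (scale y.1)) (rho x.seq y.seq)
      have := le_max_right (max (scale x.1) (scale y.1)) (rho x.seq y.seq)
      exact max_le (by linarith) (by linarith)
    · rw [if_neg hxy, if_neg hyz]
      have a1 := le_max_left (max (scale x.1) (scale y.1)) (rho x.seq y.seq)
      have a2 := le_max_right (max (scale x.1) (scale y.1)) (rho x.seq y.seq)
      have a3 := le_max_left (max (scale y.1) (scale z.1)) (rho y.seq z.seq)
      have a4 := le_max_right (max (scale y.1) (scale z.1)) (rho y.seq z.seq)
      have a5 := le_max_left (scale x.1) (scale y.1)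
      have a6 := le_max_right (scale y.1) (scale z.1)
      split_ifs
      · linarith
      · exact max_le (max_le (by linarith) (by linarith)) (by linarith)
  eq_of_dist_eq_zero := by
    intro x y h
    change Space.distance x y = 0 at h
    unfold Space.distance at h
    split_ifs at h with hxy
    · obtain ⟨a, u⟩ := x
      obtain ⟨b, v⟩ := y
      dsimp only at hxy
      subst hxy
      have : u = v := Subtype.ext (extend_injective (eq_of_rho_eq_zero h))
      rw [this]
    · exfalso
      have a1 := le_max_left (max (scale x.1) (scale y.1)) (rho x.seq y.seq)
      have a2 := le_max_left (scale x.1) (scale y.1)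
      have a3 := scale_pos x.1
      linarith

/-- The metric space `X_ξ`, the disjoint union of the spaces `X_τ` with `τ ∈ S_ξ[L]`. -/
abbrev XSpace (ζ : Ordinal.{0} → ℕ → Ordinal.{0}) (ξ : Ordinal.{0}) : Type :=
  Space (shift (S ζ ξ))

end CofinDim

namespace CofinDim

/-! ### Increasing enumerations, shifts and tails. -/

section Enumeration

/-! Let n be the finite part of the bound. Given r, take an integer R > r and N = 2^K ≥ (2n+1)R.
Points with at most n coordinates off Nℤ behave like an n-dimensional cubical skeleton:
`exists_families` covers them by n+1 bounded r-disjoint families, one for each number of coordinates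
far from Nℤ.

An uncovered point with index of the same limit part as the bound has more than n coordinates off
Nℤ, which forces its unshifted set to have more than n elements and a small entry k_{n(ξ)} < K. So
only finitely many l can occur in the recursion for S_ξ, and `S_cases` puts the set into one of
finitely many families of index below the limit part. Since one family turns into a finite union,
the transfinite induction in `coasdimLE_of_forall_mem_shift` is run for finite unions of families.
-/

theorem finite_setOf_mem (τ : Finset ℕ) : {k | k ∈ τ}.Finite := τ.finite_toSet

theorem card_setOf_mem (τ : Finset ℕ) : (finite_setOf_mem τ).toFinset.card = τ.card := by
  congr 1
  ext
  simp

theorem elt_mem {τ : Finset ℕ} {p : ℕ} (hp : p < τ.card) : elt τ p ∈ τ :=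
  Nat.nth_mem_of_lt_card (finite_setOf_mem τ) (by rwa [card_setOf_mem])

theorem elt_lt_elt {τ : Finset ℕ} {p q : ℕ} (hpq : p < q) (hq : q < τ.card) :
    elt τ p < elt τ q :=
  Nat.nth_lt_nth_of_lt_card (finite_setOf_mem τ) hpq (by rwa [card_setOf_mem])

theorem elt_eq_of_strictMonoOn {τ : Finset ℕ} {f : ℕ → ℕ} (hmem : ∀ p < τ.card, f p ∈ τ)
    (hmono : ∀ p q, p < q → q < τ.card → f p < f q) {p : ℕ} (hp : p < τ.card) :
    elt τ p = f p := by
  have h1 := Finset.orderEmbOfFin_unique (s := τ) rfl (f := fun i : Fin τ.card => elt τ i)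
    (fun i => elt_mem i.2) (fun i j hij => elt_lt_elt hij j.2)
  have h2 := Finset.orderEmbOfFin_unique (s := τ) rfl (f := fun i : Fin τ.card => f i)
    (fun i => hmem i i.2) (fun i j hij => hmono i j hij j.2)
  exact congrFun (h1.trans h2.symm) ⟨p, hp⟩

theorem card_image_add_two (σ : Finset ℕ) : (σ.image (fun k => k + 2)).card = σ.card :=
  Finset.card_image_of_injective _ (add_left_injective 2)

theorem elt_image_add_two {σ : Finset ℕ} {p : ℕ} (hp : p < σ.card) :
    elt (σ.image (fun k => k + 2)) p = elt σ p + 2 := by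
  refine elt_eq_of_strictMonoOn (f := fun p => elt σ p + 2) ?_ ?_ (by rwa [card_image_add_two])
  · intro q hq
    rw [card_image_add_two] at hq
    exact Finset.mem_image_of_mem _ (elt_mem hq)
  · intro a b hab hb
    rw [card_image_add_two] at hb
    exact Nat.add_lt_add_right (elt_lt_elt hab hb) 2

theorem card_tail (σ : Finset ℕ) (n : ℕ) : (tail σ n).card = σ.card - (n + 1) := by
  rw [tail, Finset.card_image_of_injOn, Nat.card_Ioo]
  · omega
  · intro a ha b hb hab
    simp only [Finset.coe_Ioo, Set.mem_Ioo] at ha hb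
    rcases lt_trichotomy a b with h | h | h
    · exact absurd hab (elt_lt_elt h hb.2).ne
    · exact h
    · exact absurd hab (elt_lt_elt h ha.2).ne'

theorem elt_tail {σ : Finset ℕ} {n p : ℕ} (hp : p + (n + 1) < σ.card) :
    elt (tail σ n) p = elt σ (p + (n + 1)) := by
  refine elt_eq_of_strictMonoOn (f := fun p => elt σ (p + (n + 1))) ?_ ?_
    (by rw [card_tail]; omega)
  · intro q hq
    rw [card_tail] at hq
    exact Finset.mem_image_of_mem _ (Finset.mem_Ioo.2 ⟨by omega, by omega⟩)
  · intro a b hab hb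
    rw [card_tail] at hb
    exact elt_lt_elt (by omega) (by omega)

theorem tail_tail (σ : Finset ℕ) (n q : ℕ) : tail (tail σ n) q = tail σ (q + (n + 1)) := by
  ext k
  simp only [tail, Finset.mem_image, Finset.mem_Ioo]
  rw [← tail, card_tail]
  constructor
  · rintro ⟨p, hp, rfl⟩
    exact ⟨p + (n + 1), by omega, (elt_tail (by omega)).symm⟩
  · rintro ⟨p, hp, rfl⟩
    refine ⟨p - (n + 1), by omega, ?_⟩
    rw [elt_tail (by omega)]
    congr 1
    omega

theorem idx_tail {σ : Finset ℕ} {n : ℕ} (q : ℕ) (h : n + 1 < σ.card) :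
    idx (tail σ n) q = idx σ (q + (n + 1)) := by
  rw [idx, idx, card_tail, elt_tail (by omega)]
  congr 1
  omega

end Enumeration

/-! ### Limit and finite parts of ordinals. -/

section Ordinals

theorem limitPart_add_natCast (β : Ordinal.{0}) (h : ℕ) :
    limitPart (β + (h : Ordinal.{0})) = limitPart β := by
  have hb := limitPart_add_natPart β
  unfold limitPart at hb ⊢
  congr 1
  rw [← hb, add_assoc, Ordinal.mul_add_div _ Ordinal.omega0_ne_zero,
    Ordinal.mul_add_div _ Ordinal.omega0_ne_zero, ← Nat.cast_add,
    Ordinal.div_eq_zero_of_lt (Ordinal.natCast_lt_omega0 _),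
    Ordinal.div_eq_zero_of_lt (Ordinal.natCast_lt_omega0 _)]

theorem natPart_add_natCast (β : Ordinal.{0}) (h : ℕ) :
    natPart (β + (h : Ordinal.{0})) = natPart β + h := by
  have h1 := limitPart_add_natPart (β + (h : Ordinal.{0}))
  have h2 := limitPart_add_natPart β
  rw [limitPart_add_natCast] at h1
  have h3 : limitPart β + (natPart (β + (h : Ordinal.{0})) : Ordinal.{0}) =
      limitPart β + ((natPart β + h : ℕ) : Ordinal.{0}) := by
    rw [h1, Nat.cast_add, ← add_assoc, h2]
  exact_mod_cast add_left_cancel h3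

theorem limitPart_natCast (n : ℕ) : limitPart (n : Ordinal.{0}) = 0 := by
  rw [limitPart, Ordinal.div_eq_zero_of_lt (Ordinal.natCast_lt_omega0 _), mul_zero]

theorem natPart_natCast (n : ℕ) : natPart (n : Ordinal.{0}) = n := by
  have h := limitPart_add_natPart (n : Ordinal.{0})
  rw [limitPart_natCast, zero_add] at h
  exact_mod_cast h

theorem add_natCast_lt_limitPart {β ξ : Ordinal.{0}} (h : β < limitPart ξ) (n : ℕ) :
    β + (n : Ordinal.{0}) < limitPart ξ := by
  rcases limitPart_eq_zero_or_isSuccLimit ξ with h0 | hlim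
  · rw [h0] at h
    exact absurd h not_lt_zero
  · induction n with
    | zero => simpa using h
    | succ n ih =>
      rw [Nat.cast_succ, ← add_assoc]
      exact hlim.succ_lt ih

theorem natPart_le_of_limitPart_eq {ξ μ : Ordinal.{0}} (h : ξ ≤ μ)
    (heq : limitPart ξ = limitPart μ) : natPart ξ ≤ natPart μ := by
  rw [← limitPart_add_natPart ξ, ← limitPart_add_natPart μ, heq] at h
  exact_mod_cast (add_le_add_iff_left _).1 h

theorem lt_limitPart_of_limitPart_ne {ξ μ : Ordinal.{0}} (h : ξ ≤ μ)
    (hne : limitPart ξ ≠ limitPart μ) : ξ < limitPart μ := by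
  have hle : limitPart ξ ≤ limitPart μ :=
    mul_le_mul_right (Ordinal.div_le_left h _) _
  rw [← limitPart_add_natPart ξ]
  exact add_natCast_lt_limitPart (lt_of_le_of_ne hle hne) _

end Ordinals

/-! ### Unfolding the recursion for the families. -/

section Families

variable {ζ : Ordinal.{0} → ℕ → Ordinal.{0}}

theorem mem_S_natCast {σ : Finset ℕ} (hσ : σ ∈ FinN) {n : ℕ} (h : σ.card ≤ n) :
    σ ∈ S ζ (n : Ordinal.{0}) := by
  rw [S]
  exact ⟨hσ, Or.inl ⟨limitPart_natCast n, by rwa [natPart_natCast]⟩⟩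

/-- Tails compose and `idx` shifts along with them, so the condition on the tail at `β` is the
condition on `σ` with finite part raised by `n + 1`. -/
theorem mem_S_add_of_tail_mem {σ : Finset ℕ} (hσ : σ ∈ FinN) {n : ℕ} {β : Ordinal.{0}}
    (h : tail σ n ∈ S ζ β) : σ ∈ S ζ (β + ((n + 1 : ℕ) : Ordinal.{0})) := by
  rw [S] at h ⊢
  obtain ⟨hfin, h⟩ := h
  have hcard : n + 1 < σ.card := by
    have := Finset.card_pos.2 hfin.1
    rw [card_tail] at this
    omega
  refine ⟨hσ, ?_⟩
  rw [limitPart_add_natCast, natPart_add_natCast]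
  rw [card_tail, tail_tail, idx_tail _ hcard] at h
  rcases h with ⟨h0, h⟩ | h
  · exact Or.inl ⟨h0, by omega⟩
  · exact Or.inr h

/-- A member of `S ζ ξ` is short, has a late entry in position `natPart ξ`, or belongs to one of
finitely many families of index below `limitPart ξ`. -/
theorem S_cases {σ : Finset ℕ} {ξ : Ordinal.{0}} (h : σ ∈ S ζ ξ) (K : ℕ) :
    σ.card ≤ natPart ξ ∨ (natPart ξ < σ.card ∧ K ≤ elt σ (natPart ξ)) ∨
      ((natPart ξ + 1 : ℕ) : Ordinal.{0}) < limitPart ξ ∧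
        σ ∈ S ζ ((natPart ξ + 1 : ℕ) : Ordinal.{0}) ∨
      ∃ l < K, ζ (limitPart ξ) l + (l : Ordinal.{0}) < limitPart ξ ∧
        σ ∈ S ζ (ζ (limitPart ξ) l + (l : Ordinal.{0}) + ((natPart ξ + 1 : ℕ) : Ordinal.{0})) := by
  rw [S] at h
  obtain ⟨hσ, ⟨-, h⟩ | ⟨hne, h⟩⟩ := h
  · exact Or.inl h
  · rcases le_or_gt σ.card (natPart ξ) with hc | hc
    · exact Or.inl hc
    rcases le_or_gt K (elt σ (natPart ξ)) with hK | hK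
    · exact Or.inr (Or.inl ⟨hc, hK⟩)
    refine Or.inr (Or.inr ?_)
    rcases h with h | ⟨l, -, hl, hlt, h⟩
    · left
      constructor
      · simpa using add_natCast_lt_limitPart (pos_iff_ne_zero.2 hne) (natPart ξ + 1)
      · apply mem_S_natCast hσ
        have := card_tail σ (natPart ξ)
        rw [h, Finset.card_empty] at this
        omega
    · right
      -- `σ` is long enough that the bound on `l` is the genuine entry at `natPart ξ`, which is
      -- below `K`.
      refine ⟨l, ?_, hlt, mem_S_add_of_tail_mem hσ h⟩
      rw [idx, min_eq_left (by omega)] at hl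
      omega

end Families

/-! ### Coordinates near and far from Nℤ. -/

section Skeleton

/-- The coordinates of `x` whose distance to `Nℤ` exceeds `t` (for `2 * t < N`). -/
def farSet (N t : ℤ) (x : ℕ →₀ ℤ) : Finset ℕ :=
  x.support.filter fun j => 2 * t < (x j + t) % N

/-- A zero coordinate has residue `t`, never above `2 * t`, so restricting to the support loses
nothing. -/
theorem mem_farSet {N t : ℤ} (ht : 0 ≤ t) (htN : t < N) {x : ℕ →₀ ℤ} {j : ℕ} :
    j ∈ farSet N t x ↔ 2 * t < (x j + t) % N := by
  simp only [farSet, Finset.mem_filter, Finsupp.mem_support_iff, and_iff_right_iff_imp]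
  intro h h0
  rw [h0, zero_add, Int.emod_eq_of_lt ht htN] at h
  omega

/-- Lowering the shift by `R` lowers the residue by `R` without wrap-around. -/
theorem far_spec {N t R a : ℤ} (hR : 0 ≤ R) (ht : 0 ≤ t) (h : 2 * (t + R) < (a + (t + R)) % N)
    (hN : 0 < N) : 2 * t + R < (a + t) % N ∧ (a + t) % N < N - R := by
  have h1 := Int.emod_lt_of_pos (a + (t + R)) hN
  have h2 : (a + t) % N = (a + (t + R)) % N - R := by
    have h3 : a + t = ((a + (t + R)) % N - R) + N * ((a + (t + R)) / N) := by
      have := Int.emod_add_mul_ediv (a + (t + R)) N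
      linarith
    rw [h3, Int.add_mul_emod_self_left]
    exact Int.emod_eq_of_lt (by omega) (by omega)
  omega

theorem farSet_anti {N t R : ℤ} (hR : 0 ≤ R) (ht : 0 ≤ t) (hN : t + R < N) (x : ℕ →₀ ℤ) :
    farSet N (t + R) x ⊆ farSet N t x := by
  intro j hj
  rw [mem_farSet (by omega) hN] at hj
  rw [mem_farSet ht (by omega)]
  have := far_spec hR ht hj (by omega)
  omega

theorem ediv_eq_of_far {N t R a b : ℤ} (h1 : 2 * t + R < (a + t) % N) (ht : 0 ≤ t)
    (h2 : (a + t) % N < N - R) (hab : |a - b| < R) :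
    (a + t) / N = (b + t) / N ∧ 2 * t < (b + t) % N := by
  rw [abs_lt] at hab
  have ha := Int.emod_add_mul_ediv (a + t) N
  have hb : b + t = ((a + t) % N + (b - a)) + N * ((a + t) / N) := by linarith
  have h0 : 0 ≤ (a + t) % N + (b - a) := by omega
  have h3 : (a + t) % N + (b - a) < N := by omega
  rw [hb, Int.add_mul_emod_self_left, Int.add_mul_ediv_left _ _ (by omega),
    Int.emod_eq_of_lt h0 h3, Int.ediv_eq_zero_of_lt h0 h3]
  omega

/-- `b` lies near the start of its block, so a point of a later block exceeds it by at least `N - 2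
* t ≥ R`. -/
theorem ediv_le_of_near {N t R a b : ℤ} (h2 : (b + t) % N ≤ 2 * t)
    (hN : 2 * t + R ≤ N) (hpos : 0 < N) (hab : |a - b| < R) :
    (a + t) / N ≤ (b + t) / N := by
  rw [abs_lt] at hab
  have ha := Int.emod_add_mul_ediv (a + t) N
  have hb := Int.emod_add_mul_ediv (b + t) N
  have ha0 := Int.emod_nonneg (a + t) hpos.ne'
  by_contra! h
  have : N * ((b + t) / N + 1) ≤ N * ((a + t) / N) :=
    mul_le_mul_of_nonneg_left (by omega) hpos.le
  linarith

theorem abs_sub_lt_of_ediv_eq {N t a b : ℤ} (hN : 0 < N) (h : (a + t) / N = (b + t) / N) :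
    |a - b| < N := by
  have ha := Int.emod_add_mul_ediv (a + t) N
  have hb := Int.emod_add_mul_ediv (b + t) N
  have ha0 := Int.emod_nonneg (a + t) hN.ne'
  have hb0 := Int.emod_nonneg (b + t) hN.ne'
  have ha1 := Int.emod_lt_of_pos (a + t) hN
  have hb1 := Int.emod_lt_of_pos (b + t) hN
  rw [h] at ha
  rw [abs_lt]
  constructor <;> linarith

/-- The points with exactly `i` coordinates far from `Nℤ`, all of them far with margin `R`. -/
def Stratum (N R t : ℤ) (i : ℕ) (x : ℕ →₀ ℤ) : Prop :=
  (farSet N t x).card = i ∧ farSet N t x ⊆ farSet N (t + R) x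

theorem exists_stratum {N R : ℤ} {n : ℕ} (hR : 0 < R) (hN : (2 * n + 1) * R ≤ N)
    {x : ℕ →₀ ℤ} (hx : (farSet N 0 x).card ≤ n) :
    ∃ i : Fin (n + 1), Stratum N R ((n - (i : ℕ) : ℤ) * R) i x := by
  classical
  -- The least such `i` works; `i = n` qualifies because its tolerance is 0.
  have hex : ∃ i : ℕ, (farSet N ((n - i : ℤ) * R) x).card ≤ i := ⟨n, by simpa using hx⟩
  have hle : Nat.find hex ≤ n := Nat.find_min' hex (by simpa using hx)
  have hspec := Nat.find_spec hex
  have hmin := fun m => Nat.find_min (m := m) hex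
  generalize Nat.find hex = i at hle hspec hmin
  refine ⟨⟨i, by omega⟩, ?_⟩
  -- The tolerance of `i - 1` is that of `i` plus `R`, so minimality gives at least `i` coordinates
  -- far with margin. At most `i` are far at all, so the two sets agree.
  have hkey : ∃ J ⊆ farSet N ((n - i : ℤ) * R + R) x, J ⊆ farSet N ((n - i : ℤ) * R) x ∧
      i ≤ J.card := by
    rcases i with _ | i
    · exact ⟨∅, by simp, by simp, by simp⟩
    · have hm := hmin i (by omega)
      have hti : (n - (i + 1 : ℕ) : ℤ) * R + R = (n - i : ℤ) * R := by push_cast; ring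
      have hcast : ((i + 1 : ℕ) : ℤ) ≤ n := by exact_mod_cast hle
      have h0 : 0 ≤ (n - (i + 1 : ℕ) : ℤ) * R := mul_nonneg (by omega) hR.le
      have hi0 : 0 ≤ (i : ℤ) * R := by positivity
      have hn0 : 0 ≤ (n : ℤ) * R := by positivity
      refine ⟨_, subset_rfl, farSet_anti hR.le h0 ?_ x, ?_⟩
      · rw [hti]
        linarith
      · rw [hti]
        omega
  obtain ⟨J, hJ, hJ', hcard⟩ := hkey
  have hJe : J = farSet N ((n - i : ℤ) * R) x := Finset.eq_of_subset_of_card_le hJ' (by omega)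
  constructor
  · rw [hJe] at hcard
    exact le_antisymm hspec hcard
  · rw [hJe] at hJ
    exact hJ

/-- A coordinate far for one point stays in its block thanks to the margin `R`; one near for both
points cannot jump between multiples of `N`. -/
theorem label_eq_of_close {N R t : ℤ} {i : ℕ} (hR : 0 < R) (ht : 0 ≤ t) (hN : 2 * t + R ≤ N)
    (htR : t + R < N ∨ i = 0) {x y : ℕ →₀ ℤ} (hx : Stratum N R t i x) (hy : Stratum N R t i y)
    (hxy : ∀ j, |x j - y j| < R) (j : ℕ) : (x j + t) / N = (y j + t) / N := by
  have hpos : 0 < N := by omega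
  have hstrong : ∀ z, Stratum N R t i z → j ∈ farSet N t z →
      2 * t + R < (z j + t) % N ∧ (z j + t) % N < N - R := by
    intro z hz hj
    rcases htR with h | h
    · exact far_spec hR.le ht ((mem_farSet (by omega) h).1 (hz.2 hj)) hpos
    · rw [h] at hz
      rw [Finset.card_eq_zero.1 hz.1] at hj
      simp at hj
  by_cases hjx : j ∈ farSet N t x
  · exact (ediv_eq_of_far (hstrong x hx hjx).1 ht (hstrong x hx hjx).2 (hxy j)).1
  by_cases hjy : j ∈ farSet N t y
  · exact (ediv_eq_of_far (hstrong y hy hjy).1 ht (hstrong y hy hjy).2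
      (by rw [abs_sub_comm]; exact hxy j)).1.symm
  rw [mem_farSet ht (by omega), not_lt] at hjx hjy
  exact le_antisymm (ediv_le_of_near hjy hN hpos (hxy j))
    (ediv_le_of_near hjx hN hpos (by rw [abs_sub_comm]; exact hxy j))

end Skeleton

/-! ### Covering points with few coordinates off Nℤ. -/

section Cover

theorem rDisjoint_fibers {X κ : Type*} [MetricSpace X] {r : ℝ} {B : Set X} {key : X → κ}
    (h : ∀ x ∈ B, ∀ y ∈ B, dist x y < r → key x = key y) :
    RDisjoint r (Set.range fun k => {x | x ∈ B ∧ key x = k}) := by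
  rintro _ ⟨k, rfl⟩ _ ⟨l, rfl⟩ hne x ⟨hx, rfl⟩ y ⟨hy, rfl⟩
  by_contra! hlt
  exact hne (by simp only [h x hx y hy hlt])

theorem uniformlyBounded_fibers {X κ : Type*} [MetricSpace X] {R : ℝ} {B : Set X} {key : X → κ}
    (h : ∀ x y, key x = key y → dist x y ≤ R) :
    UniformlyBounded (Set.range fun k => {x | x ∈ B ∧ key x = k}) := by
  refine ⟨R, ?_⟩
  rintro _ ⟨k, rfl⟩ x ⟨-, hx⟩ y ⟨-, hy⟩
  exact h x y (hx.trans hy.symm)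

variable {T : Set (Finset ℕ)}

theorem Space.dist_def (x y : Space T) : dist x y = Space.distance x y := rfl

theorem Space.rho_le_dist (x y : Space T) : rho x.seq y.seq ≤ dist x y := by
  rw [Space.dist_def, Space.distance]
  split_ifs
  · exact le_rfl
  · exact le_max_right _ _

/-- The index of the piece containing `x`, all pieces of scale below `r` being identified. -/
noncomputable def Space.cls (r : ℝ) (x : Space T) : Option T :=
  if scale x.1 < r then none else some x.1

/-- Distinct pieces are at least as far apart as either scale, so only pieces of scale below `r` can
interact. -/
theorem Space.cls_eq_of_dist_lt {r : ℝ} {x y : Space T} (h : dist x y < r) :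
    x.cls r = y.cls r := by
  rw [Space.dist_def, Space.distance] at h
  split_ifs at h with hxy
  · rw [Space.cls, Space.cls, hxy]
  · have h1 := (le_max_left _ _).trans_lt ((le_max_left _ _).trans_lt h)
    have h2 := (le_max_right _ _).trans_lt ((le_max_left _ _).trans_lt h)
    rw [Space.cls, Space.cls, if_pos h1, if_pos h2]

theorem Space.dist_le_of_cls_eq {r : ℝ} {x y : Space T} (h : x.cls r = y.cls r) :
    dist x y ≤ max r (rho x.seq y.seq) := by
  rw [Space.dist_def, Space.distance]
  unfold Space.cls at h
  split_ifs at h ⊢ with h1 h2 h3 h4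
  all_goals first
    | exact le_max_right _ _
    | exact max_le_max (max_le (le_of_lt ‹_›) (le_of_lt ‹_›)) le_rfl
    | exact absurd (Option.some.inj h) ‹_›

/-- The points of the disjoint union with at most `n` coordinates outside `Nℤ` are covered by
`n + 1` uniformly bounded `r`-disjoint families. -/
theorem exists_families (A : Set (Space T)) (n : ℕ) {r : ℝ} {R N : ℤ} (hR : 0 < R) (hr : r ≤ R)
    (hN : (2 * n + 1) * R ≤ N) :
    ∃ 𝒰 : Fin (n + 1) → Set (Set (Space T)),
      (∀ i, (∀ U ∈ 𝒰 i, U ⊆ A) ∧ RDisjoint r (𝒰 i) ∧ UniformlyBounded (𝒰 i)) ∧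
      ∀ x ∈ A, (farSet N 0 x.seq).card ≤ n → x ∈ ⋃ i, ⋃₀ 𝒰 i := by
  have hn0 : 0 ≤ (n : ℤ) * R := by positivity
  have hpos : 0 < N := by linarith
  let t : Fin (n + 1) → ℤ := fun i => (n - (i : ℕ) : ℤ) * R
  let B : Fin (n + 1) → Set (Space T) := fun i => {x | x ∈ A ∧ Stratum N R (t i) i x.seq}
  let key : Fin (n + 1) → Space T → Option T × (ℕ → ℤ) :=
    fun i x => (x.cls r, fun j => (x.seq j + t i) / N)
  refine ⟨fun i => Set.range fun k => {x | x ∈ B i ∧ key i x = k}, fun i => ⟨?_, ?_, ?_⟩, ?_⟩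
  · rintro _ ⟨k, rfl⟩ x hx
    exact hx.1.1
  · apply rDisjoint_fibers
    intro x hx y hy hxy
    refine Prod.ext (Space.cls_eq_of_dist_lt hxy) (funext ?_)
    have hi : ((i : ℕ) : ℤ) ≤ n := by exact_mod_cast Nat.lt_succ_iff.1 i.2
    have ht : 0 ≤ t i := mul_nonneg (by omega) hR.le
    have hi0 : 0 ≤ ((i : ℕ) : ℤ) * R := by positivity
    have htn : t i = n * R - (i : ℕ) * R := sub_mul _ _ _
    refine label_eq_of_close hR ht (by linarith) ?_ hx.2 hy.2 ?_
    -- The case `i = 0` is separate because `t i + R` may equal `N` when `n = 0`.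
    · rcases Nat.eq_zero_or_pos (i : ℕ) with h | h
      · exact Or.inr h
      · left
        have : (1 : ℤ) * R ≤ ((i : ℕ) : ℤ) * R :=
          mul_le_mul_of_nonneg_right (by exact_mod_cast h) hR.le
        linarith
    · intro j
      have h1 := (abs_sub_le_rho x.seq y.seq j).trans_lt
        (((Space.rho_le_dist x y).trans_lt hxy).trans_le hr)
      exact_mod_cast h1
  · apply uniformlyBounded_fibers (R := max r N)
    intro x y hxy
    refine (Space.dist_le_of_cls_eq (congrArg Prod.fst hxy)).trans (max_le_max le_rfl ?_)
    rw [rho_le_iff (by exact_mod_cast hpos.le)]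
    intro j
    have := abs_sub_lt_of_ediv_eq hpos (congrFun (congrArg Prod.snd hxy) j)
    exact_mod_cast this.le
  · intro x hx hcard
    obtain ⟨i, hi⟩ := exists_stratum hR hN hcard
    exact Set.mem_iUnion.2 ⟨i, _, ⟨key i x, rfl⟩, ⟨hx, hi⟩, rfl⟩

theorem farSet_zero_card_le {n : ℕ} (x : Fin n → ℤ) (N : ℤ) :
    (farSet N 0 (extend x)).card ≤ Set.ncard {j : Fin n | ¬ N ∣ x j} := by
  classical
  rw [← Set.ncard_image_of_injective _ Fin.val_injective, ← Set.ncard_coe_finset]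
  apply Set.ncard_le_ncard _ (Set.toFinite _)
  intro j hj
  simp only [farSet, add_zero, mul_zero, Finset.coe_filter, Set.mem_ofPred_eq,
    Finsupp.mem_support_iff] at hj
  have hjn : j < n := by
    by_contra h
    exact hj.1 (by simp [extend, h])
  refine ⟨⟨j, hjn⟩, ?_, rfl⟩
  have hx := extend_apply x ⟨j, hjn⟩
  simp only at hx
  rw [Set.mem_ofPred_eq, ← hx]
  exact fun hdvd => hj.2.ne' (Int.emod_eq_zero_of_dvd hdvd)

theorem farSet_card_le_card (x : Space T) (N : ℤ) :
    (farSet N 0 x.seq).card ≤ x.1.1.card :=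
  (farSet_zero_card_le x.2.1 N).trans ((Set.ncard_le_card _).trans (by simp))

/-- Divisibility by the modulus of `piece` at position `p` implies divisibility by `2 ^ K`; the `2`
compensates the shift. -/
theorem farSet_card_le_of_elt (x : Space T) {p K : ℕ} (hp : p < x.1.1.card)
    (hK : K + 2 ≤ elt x.1.1 p) : (farSet (2 ^ K) 0 x.seq).card ≤ p := by
  refine (farSet_zero_card_le x.2.1 _).trans
    ((Set.ncard_le_ncard ?_ (Set.toFinite _)).trans (x.2.2.2 ⟨p, hp⟩))
  intro j hj hdvd
  exact hj ((pow_dvd_pow 2 (by simp only; omega)).trans hdvd)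

end Cover

/-! ### The transfinite induction. -/

theorem coasdimLE_of_forall_mem_shift {ζ : Ordinal.{0} → ℕ → Ordinal.{0}} {T : Set (Finset ℕ)}
    (μ : Ordinal.{0}) (F : Finset Ordinal.{0}) (hF : ∀ ξ ∈ F, ξ ≤ μ) (A : Set (Space T))
    (hA : ∀ x ∈ A, ∃ ξ ∈ F, x.1.1 ∈ shift (S ζ ξ)) : CoasdimLE μ A := by
  classical
  induction μ using WellFoundedLT.induction generalizing F A with
  | ind μ ih =>
  rw [CoasdimLE]
  intro r hr
  set n := natPart μ with hn
  obtain ⟨R, hR⟩ := exists_nat_gt r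
  have hR0 : 0 < (R : ℤ) := by exact_mod_cast hr.trans hR
  let K := (2 * n + 1) * R
  have hN : (2 * n + 1) * (R : ℤ) ≤ 2 ^ K := by
    have := (Nat.lt_two_pow_self (n := K)).le
    exact_mod_cast this
  obtain ⟨𝒰, h𝒰, hcover⟩ := exists_families A n hR0 (by exact_mod_cast hR.le) hN
  refine ⟨𝒰, h𝒰, ?_⟩
  -- Every index an uncovered point may need: old ones already below the limit part, finite ones
  -- from empty tails, and those from `l < K`.
  let F' : Finset Ordinal.{0} := (F ∪ (Finset.range (n + 1)).image (fun m => ((m + 1 : ℕ) :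
    Ordinal.{0})) ∪ (Finset.range K ×ˢ Finset.range (n + 1)).image (fun q =>
      ζ (limitPart μ) q.1 + (q.1 : Ordinal.{0}) + ((q.2 + 1 : ℕ) : Ordinal.{0}))).filter
        (fun ξ => ξ < limitPart μ)
  have hF' : ∀ x ∈ A \ ⋃ i, ⋃₀ 𝒰 i, ∃ ξ ∈ F', x.1.1 ∈ shift (S ζ ξ) := by
    rintro x ⟨hxA, hx⟩
    obtain ⟨ξ, hξ, σ, hσ, hτ⟩ := hA x hxA
    have hbig : ¬ (farSet (2 ^ K) 0 x.seq).card ≤ n := fun h => hx (hcover x hxA h)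
    by_cases hlim : limitPart ξ = limitPart μ
    · have hle := natPart_le_of_limitPart_eq (hF ξ hξ) hlim
      have hcard : x.1.1.card = σ.card := by rw [hτ, card_image_add_two]
      have hcases := S_cases hσ K
      rw [hlim] at hcases
      -- A short set or a late entry leaves at most `n` coordinates off Nℤ, so the point was
      -- covered.
      rcases hcases with h | ⟨h1, h2⟩ | ⟨h1, h2⟩ | ⟨l, hl, h1, h2⟩
      · exact absurd ((farSet_card_le_card x _).trans (by omega)) hbig
      · refine absurd ((farSet_card_le_of_elt x (p := natPart ξ) (by omega) ?_).trans hle) hbig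
        rw [hτ, elt_image_add_two h1]
        omega
      · refine ⟨_, Finset.mem_filter.2 ⟨?_, h1⟩, σ, h2, hτ⟩
        refine Finset.mem_union_left _ (Finset.mem_union_right _ (Finset.mem_image.2
          ⟨natPart ξ, Finset.mem_range.2 (by omega), rfl⟩))
      · refine ⟨_, Finset.mem_filter.2 ⟨?_, add_natCast_lt_limitPart h1 _⟩, σ, h2, hτ⟩
        exact Finset.mem_union_right _ (Finset.mem_image.2 ⟨(l, natPart ξ),
          Finset.mem_product.2 ⟨Finset.mem_range.2 hl, Finset.mem_range.2 (by simp only; omega)⟩,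
          rfl⟩)
    · exact ⟨ξ, Finset.mem_filter.2 ⟨Finset.mem_union_left _ (Finset.mem_union_left _ hξ),
        lt_limitPart_of_limitPart_ne (hF ξ hξ) hlim⟩, σ, hσ, hτ⟩
  rcases F'.eq_empty_or_nonempty with h0 | h0
  · left
    rw [Set.eq_empty_iff_forall_notMem]
    intro x hx
    obtain ⟨ξ, hξ, -⟩ := hF' x hx
    simp [h0] at hξ
  · right
    -- Finiteness of `F'` makes its maximum a single `β` below the limit part.
    have hlt : F'.max' h0 < limitPart μ := (Finset.mem_filter.1 (F'.max'_mem h0)).2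
    exact ⟨F'.max' h0, hlt, ih _ (hlt.trans_le (limitPart_le μ)) F' (fun ξ hξ => F'.le_max' ξ hξ)
      _ hF'⟩

end CofinDim

theorem mainTheorem3 (ζ : Ordinal.{0} → ℕ → Ordinal.{0}) (hζ : CofinDim.IsFundamental ζ)
    (ξ : Ordinal.{0}) (hξ : ξ.card ≤ Cardinal.aleph0) :
    CofinDim.CoasdimLE ξ (Set.univ : Set (CofinDim.XSpace ζ ξ)) :=
  CofinDim.coasdimLE_of_forall_mem_shift ξ {ξ} (by simp) _
    fun x _ => ⟨ξ, Finset.mem_singleton_self ξ, x.1.2⟩
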